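/- Let $\mathbb D=\{z\in\mathbb C:|z|<1\}$, and let $\gamma:S^1=\partial\mathbb D\to\mathbb C$ be a closed, continuous, piecewise smooth curve whose (one-sided) derivatives $\gamma'$ with respect to the angle $\theta$ vanish nowhere. A \emph{distorted disk bounded by $\gamma$} is a continuous map $F:\overline{\mathbb D}\to\mathbb C$ with $F|_{\partial\mathbb D}=\gamma$ whose restriction to $\mathbb D$ is an orientation-preserving immersion, i.e. is real differentiable with $\det \mathrm dF>0$ at every point of $\mathbb D$. The curve $\gamma$ is \emph{self-overlapping} if it bounds at least one distorted disk. The \emph{number of layers} of $F$ at $P\in\mathbb C$ is the number of points $z\in\mathbb D$ with $F(z)=P$. The winding number of $\gamma$ around $P\in\mathbb C\setminus\operatorname{Im}\gamma$ is $$\nu_\gamma(P)=\frac1{2i\pi}\int_0^{2\pi}\frac{\gamma'(\theta)}{\gamma(\theta)-P}\,\mathrm d\theta .$$ Proposition. Let $\gamma$ be self-overlapping, let $F$ be any distorted disk bounded by $\gamma$, and let $\Omega$ be any bounded connected component of $\mathbb C\setminus\operatorname{Im}\gamma$. Then the number of layers of $F$ is finite and takes the same value $\nu$ at all points of $\Omega$,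 and $\nu_\gamma(P)=\nu$ for every $P\in\Omega$. In particular, $\nu_\gamma(P)$ is a nonnegative integer for every $P\in\mathbb C\setminus\operatorname{Im}\gamma$. -/

import Mathlib

open scoped ContDiff

noncomputable section

namespace SelfOverlapping

/-- The angular parametrization `θ ↦ γ (e^{iθ})` of a closed curve `γ : S¹ → ℂ`. -/
def angular (γ : Circle → ℂ) (θ : ℝ) : ℂ := γ (Circle.exp θ)

/-- `γ` is a closed, continuous, piecewise smooth curve with nowhere vanishing velocity: `[0, 2π]`
is cut into finitely many closed intervals, on each of which `θ ↦ γ (e^{iθ})` is smooth up to the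
endpoints, with nonzero (at the endpoints: one-sided) derivative. Corners and self-intersections
are allowed. -/
def IsPiecewiseSmoothClosedCurve (γ : Circle → ℂ) : Prop :=
  Continuous γ ∧
    ∃ (n : ℕ) (t : ℕ → ℝ), t 0 = 0 ∧ t n = 2 * Real.pi ∧
      ∀ i < n, t i < t (i + 1) ∧
        ContDiffOn ℝ ∞ (angular γ) (Set.Icc (t i) (t (i + 1))) ∧
        ∀ θ ∈ Set.Icc (t i) (t (i + 1)),
          derivWithin (angular γ) (Set.Icc (t i) (t (i + 1))) θ ≠ 0

/-- The winding number `(1 / 2πi) ∫₀^{2π} γ'(θ) / (γ(θ) - P) dθ` of `γ` around `P`. It is only used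
for `P` off the curve; at the finitely many corners the integrand is irrelevant. -/
def windingNumber (γ : Circle → ℂ) (P : ℂ) : ℂ :=
  (2 * Real.pi * Complex.I)⁻¹ *
    ∫ θ in (0 : ℝ)..(2 * Real.pi), deriv (angular γ) θ / (angular γ θ - P)

/-- `F` is a distorted disk with continuous boundary values: a map that is continuous on the closed
unit disk and an orientation-preserving immersion of the open unit disk into the plane, that is to
say, real differentiable with differential of positive determinant at every point of the open disk.
(Only the values of `F` on the closed disk matter.) -/
structure IsDistortedDisk (F : ℂ → ℂ) : Prop where
  continuousOn : ContinuousOn F (Metric.closedBall 0 1)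
  differentiableAt : ∀ z ∈ Metric.ball (0 : ℂ) 1, DifferentiableAt ℝ F z
  det_pos : ∀ z ∈ Metric.ball (0 : ℂ) 1, 0 < (fderiv ℝ F z).det

/-- `γ` bounds the distorted disk `F`: `F` is a distorted disk whose restriction to the unit circle
is `γ`. -/
def Bounds (γ : Circle → ℂ) (F : ℂ → ℂ) : Prop :=
  IsDistortedDisk F ∧ ∀ u : Circle, F (u : ℂ) = γ u

/-- `γ` is self-overlapping: a closed piecewise smooth immersed curve that bounds a distorted
disk. -/
def IsSelfOverlapping (γ : Circle → ℂ) : Prop :=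
  IsPiecewiseSmoothClosedCurve γ ∧ ∃ F : ℂ → ℂ, Bounds γ F

/-- `Ω` is a bounded connected component of the complement of the image of `γ`. -/
def IsBoundedComponent (γ : Circle → ℂ) (Ω : Set ℂ) : Prop :=
  Bornology.IsBounded Ω ∧
    ∃ P ∈ (Set.range γ)ᶜ, Ω = connectedComponentIn (Set.range γ)ᶜ P

/-- The number of layers of the distorted disk `F` at `P`: the number, possibly infinite, of
preimages of `P` in the open unit disk. -/
def layersAt (F : ℂ → ℂ) (P : ℂ) : ℕ∞ :=
  {z ∈ Metric.ball (0 : ℂ) 1 | F z = P}.encard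

end SelfOverlapping

end

/-! Both numbers count the zeros of `F - P`: this is the argument principle. As `F` is only
differentiable, no local inverse is used. At a zero `p`, positivity of the determinant keeps `(F z -
P) / (z - p)` in a disk avoiding `0` (`avoidsZeroNear_div_sub`), so zeros are isolated, hence finite
in number by compactness. Divide `F - P` by the product of the `z - p` and fill the holes
(`exists_continuousOn_ne_zero`): the result has a continuous logarithm on the closed disk, so only
the factors `z - p` wind, once each. The integral is the variation of a logarithm
(`windingNumber_eq_of_exp_eq`) and is locally constant in `P`, which makes the count constant on
components. -/

namespace SelfOverlapping

open Complex Filter Topology Set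

/-! ### Behaviour near a zero. -/

/-- Away from `p`, the function `H` takes values near `p` in a closed disk that does not
contain `0`. -/
def AvoidsZeroNear (H : ℂ → ℂ) (p : ℂ) : Prop :=
  ∃ (c : ℂ) (ρ : ℝ), ρ < ‖c‖ ∧ ∀ᶠ z in 𝓝[≠] p, ‖H z - c‖ ≤ ρ

theorem AvoidsZeroNear.eventually_ne {H : ℂ → ℂ} {p : ℂ} (h : AvoidsZeroNear H p) :
    ∀ᶠ z in 𝓝[≠] p, H z ≠ 0 := by
  obtain ⟨c, ρ, hρ, h⟩ := h
  filter_upwards [h] with z hz h0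
  rw [h0, zero_sub, norm_neg] at hz
  linarith

theorem AvoidsZeroNear.congr {H H' : ℂ → ℂ} {p : ℂ} (h : AvoidsZeroNear H p)
    (hH : H' =ᶠ[𝓝[≠] p] H) : AvoidsZeroNear H' p := by
  obtain ⟨c, ρ, hρ, h⟩ := h
  refine ⟨c, ρ, hρ, ?_⟩
  filter_upwards [h, hH] with z hz hz'
  rwa [hz']

theorem AvoidsZeroNear.mul {H u : ℂ → ℂ} {p : ℂ} (h : AvoidsZeroNear H p)
    (hu : ContinuousAt u p) (hp : u p ≠ 0) : AvoidsZeroNear (fun z => H z * u z) p := by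
  obtain ⟨c, ρ, hρ, h⟩ := h
  have hlt : ρ * ‖u p‖ < ‖c * u p‖ := by
    rw [norm_mul]
    exact mul_lt_mul_of_pos_right hρ (norm_pos_iff.2 hp)
  obtain ⟨σ, h1, h2⟩ := exists_between hlt
  refine ⟨c * u p, σ, h2, ?_⟩
  have hlim : ContinuousAt (fun z => ρ * ‖u z‖ + ‖c‖ * ‖u z - u p‖) p := by fun_prop
  have hev : ∀ᶠ z in 𝓝 p, ρ * ‖u z‖ + ‖c‖ * ‖u z - u p‖ < σ :=
    hlim.eventually_lt continuousAt_const (by simpa using h1)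
  filter_upwards [h, hev.filter_mono nhdsWithin_le_nhds] with z hz hz'
  calc ‖H z * u z - c * u p‖ = ‖(H z - c) * u z + c * (u z - u p)‖ := by ring_nf
    _ ≤ ‖H z - c‖ * ‖u z‖ + ‖c‖ * ‖u z - u p‖ := by
      simpa only [norm_mul] using norm_add_le ((H z - c) * u z) (c * (u z - u p))
    _ ≤ ρ * ‖u z‖ + ‖c‖ * ‖u z - u p‖ := by gcongr
    _ ≤ σ := hz'.le

/-- A real linear map of the plane with positive determinant is `h ↦ a h + b h̄` with
`|b| < |a|`. -/
theorem exists_eq_mul_add_mul_conj (A : ℂ →L[ℝ] ℂ) (hA : 0 < A.det) :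
    ∃ a b : ℂ, ‖b‖ < ‖a‖ ∧ ∀ h, A h = a * h + b * (starRingEnd ℂ) h := by
  -- These are the Wirtinger coefficients, for which `|a|² - |b|² = det A`.
  refine ⟨(A 1 - I * A I) / 2, (A 1 + I * A I) / 2, ?_, fun h => ?_⟩
  · have hdet : A.det = (A 1).re * (A I).im - (A I).re * (A 1).im := by
      rw [ContinuousLinearMap.det, ← LinearMap.det_toMatrix basisOneI, Matrix.det_fin_two]
      simp [LinearMap.toMatrix_apply]
    rw [hdet] at hA
    rw [← sq_lt_sq₀ (norm_nonneg _) (norm_nonneg _), ← normSq_eq_norm_sq, ← normSq_eq_norm_sq]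
    simp [normSq_apply]
    nlinarith
  · have hh : A h = h.re * A 1 + h.im * A I := by
      conv_lhs => rw [show h = h.re • (1 : ℂ) + h.im • I by simp [re_add_im]]
      rw [map_add, map_smul, map_smul, real_smul, real_smul]
    rw [hh]
    apply Complex.ext <;> simp <;> ring

/-- The quotient is `a + b h̄ / h + o(1)` with `h = z - p`, so any radius strictly between `|b|` and
`|a|` works around the center `a`. -/
theorem avoidsZeroNear_div_sub {G : ℂ → ℂ} {A : ℂ →L[ℝ] ℂ} {p : ℂ} (hG : HasFDerivAt G A p)
    (hp : G p = 0) (hA : 0 < A.det) : AvoidsZeroNear (fun z => G z / (z - p)) p := by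
  obtain ⟨a, b, hab, hA⟩ := exists_eq_mul_add_mul_conj A hA
  obtain ⟨ρ, h1, h2⟩ := exists_between hab
  refine ⟨a, ρ, h2, ?_⟩
  have hev := (hasFDerivAt_iff_isLittleO.1 hG).bound (sub_pos.2 h1)
  filter_upwards [hev.filter_mono nhdsWithin_le_nhds, self_mem_nhdsWithin] with z hz hne
  have hz0 : z - p ≠ 0 := sub_ne_zero.2 hne
  rw [hp, hA, sub_zero] at hz
  rw [div_sub' hz0, norm_div, div_le_iff₀ (norm_pos_iff.2 hz0)]
  calc ‖G z - (z - p) * a‖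
      = ‖(G z - (a * (z - p) + b * (starRingEnd ℂ) (z - p))) + b * (starRingEnd ℂ) (z - p)‖ := by
        ring_nf
    _ ≤ (ρ - ‖b‖) * ‖z - p‖ + ‖b‖ * ‖z - p‖ := by
        refine (norm_add_le _ _).trans (add_le_add hz ?_)
        rw [norm_mul, RCLike.norm_conj]
    _ = ρ * ‖z - p‖ := by ring

/-! ### Filling in the singularities. -/

/-- Finitely many point singularities at which a nowhere vanishing function stays in a disk
avoiding zero can be filled in, without changing the function on a given closed set. -/
theorem exists_continuousOn_ne_zero {K C : Set ℂ} (hC : IsClosed C) (S : Finset ℂ)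
    (H : ℂ → ℂ) (hCS : Disjoint C S) (hc : ContinuousOn H (K \ S))
    (h0 : ∀ z ∈ K \ S, H z ≠ 0) (hS : ∀ p ∈ S, AvoidsZeroNear H p) :
    ∃ H' : ℂ → ℂ, ContinuousOn H' K ∧ (∀ z ∈ K, H' z ≠ 0) ∧ EqOn H' H C := by
  classical
  induction S using Finset.induction_on generalizing H with
  | empty => exact ⟨H, by simpa using hc, by simpa using h0, fun _ _ => rfl⟩
  | insert p S hpS ih =>
    rw [Finset.coe_insert, Set.disjoint_insert_right] at hCS
    obtain ⟨c, ρ, hρ, hp⟩ := hS p (Finset.mem_insert_self _ _)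
    have hfar : ∀ᶠ z in 𝓝 p, z ∉ C ∪ S :=
      (hC.union S.finite_toSet.isClosed).isOpen_compl.mem_nhds (by simp [hCS.1, hpS])
    rw [eventually_nhdsWithin_iff] at hp
    obtain ⟨δ, hδ, hball⟩ := Metric.nhds_basis_closedBall.mem_iff.1 (hp.and hfar)
    set χ : ℂ → ℝ := fun z => max 0 (min 1 (2 * dist z p / δ - 1)) with hχ
    have hχc : Continuous χ := by fun_prop
    have hχ0 : ∀ z, 0 ≤ χ z := fun z => le_max_left _ _
    have hχ1 : ∀ z, χ z ≤ 1 := fun z => max_le zero_le_one (min_le_left _ _)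
    have hχfar : ∀ z, δ ≤ dist z p → χ z = 1 := by
      intro z hz
      have : 1 ≤ dist z p / δ := (one_le_div hδ).2 hz
      simp only [hχ]
      rw [min_eq_left (by linarith [mul_div_assoc 2 (dist z p) δ]), max_eq_right zero_le_one]
    have hχnear : ∀ z, dist z p < δ / 2 → χ z = 0 := by
      intro z hz
      have : dist z p / δ < 1 / 2 := by rw [div_lt_iff₀ hδ]; linarith
      exact max_eq_left ((min_le_right _ _).trans (by linarith [mul_div_assoc 2 (dist z p) δ]))
    -- `H1` passes from the constant `c` near `p` to `H` at distance `δ`; in between it stays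
    -- nonzero because the disk about `c` is convex.
    set H1 : ℂ → ℂ := fun z => χ z * H z + (1 - χ z) * c with hH1
    have hfarH : ∀ z, δ ≤ dist z p → H1 z = H z := by
      intro z hz
      simp [hH1, hχfar z hz]
    have hout : ∀ z ∈ C ∪ S, δ < dist z p := by
      intro z hz
      by_contra! hle
      exact (hball (Metric.mem_closedBall.2 hle)).2 hz
    suffices h : ContinuousOn H1 (K \ S) ∧ (∀ z ∈ K \ S, H1 z ≠ 0) ∧
        ∀ q ∈ S, AvoidsZeroNear H1 q by
      obtain ⟨H', h1, h2, h3⟩ := ih H1 hCS.2 h.1 h.2.1 h.2.2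
      exact ⟨H', h1, h2, fun z hz => (h3 hz).trans (hfarH z (hout z (Or.inl hz)).le)⟩
    refine ⟨?_, ?_, ?_⟩
    · intro z hz
      by_cases hzp : z = p
      · subst hzp
        refine ContinuousAt.continuousWithinAt ?_
        refine (continuousAt_const (y := c)).congr ?_
        filter_upwards [Metric.ball_mem_nhds z (half_pos hδ)] with w hw
        simp [hH1, hχnear w hw]
      · have hzH : ContinuousWithinAt H (K \ S) z := by
          refine (hc z ⟨hz.1, by simpa [hzp] using hz.2⟩).mono_of_mem_nhdsWithin ?_
          rw [mem_nhdsWithin]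
          refine ⟨{p}ᶜ, isOpen_compl_singleton, hzp, ?_⟩
          rintro w ⟨hw1, hw2⟩
          exact ⟨hw2.1, by simpa using ⟨hw1, hw2.2⟩⟩
        have hχz : ContinuousWithinAt (fun w => (χ w : ℂ)) (K \ S) z := by fun_prop
        exact (hχz.mul hzH).add ((continuousWithinAt_const.sub hχz).mul continuousWithinAt_const)
    · intro z hz
      rcases le_or_gt δ (dist z p) with hd | hd
      · rw [hfarH z hd]
        refine h0 z ⟨hz.1, ?_⟩
        have : z ≠ p := dist_pos.1 (hδ.trans_le hd)
        simpa [this] using hz.2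
      · intro hzero
        have hle : ‖H1 z - c‖ ≤ ρ := by
          by_cases hzp : z = p
          · have : χ z = 0 := hχnear z (by simpa [hzp] using hδ)
            have hρ0 : 0 ≤ ρ := by
              obtain ⟨w, hw⟩ := ((eventually_nhdsWithin_iff.2 hp)).exists
              exact (norm_nonneg _).trans hw
            simpa [hH1, this] using hρ0
          · have hz' := (hball (Metric.mem_closedBall.2 hd.le)).1 hzp
            have : H1 z - c = χ z * (H z - c) := by simp only [hH1]; ring
            rw [this, norm_mul, norm_real, Real.norm_of_nonneg (hχ0 z)]
            nlinarith [norm_nonneg (H z - c), hχ0 z, hχ1 z]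
        rw [hzero, zero_sub, norm_neg] at hle
        linarith
    · intro q hq
      refine (hS q (Finset.mem_insert_of_mem hq)).congr ?_
      refine Filter.Eventually.filter_mono nhdsWithin_le_nhds ?_
      have : ∀ᶠ z in 𝓝 q, δ < dist z p :=
        continuousAt_const.eventually_lt (by fun_prop) (hout q (Or.inr hq))
      filter_upwards [this] with z hz using hfarH z hz.le

/-! ### Logarithms and the argument principle. -/

/-- A nowhere vanishing continuous function on the closed unit disk has a continuous logarithm. -/
theorem exists_continuous_exp_eq {H : ℂ → ℂ} (hc : ContinuousOn H (Metric.closedBall 0 1))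
    (h0 : ∀ z ∈ Metric.closedBall (0 : ℂ) 1, H z ≠ 0) :
    ∃ L : ℂ → ℂ, Continuous L ∧ ∀ z ∈ Metric.closedBall (0 : ℂ) 1, exp (L z) = H z := by
  -- The radial retraction onto the disk extends `H` to the simply connected open plane.
  set r : ℂ → ℂ := fun z => (max 1 ‖z‖)⁻¹ • z with hr
  have hpos : ∀ z : ℂ, 0 < max 1 ‖z‖ := fun z => lt_max_of_lt_left one_pos
  have hrc : Continuous r :=
    ((continuous_const.max continuous_norm).inv₀ fun z => (hpos z).ne').smul continuous_id
  have hmem : ∀ z, r z ∈ Metric.closedBall (0 : ℂ) 1 := by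
    intro z
    rw [mem_closedBall_zero_iff, norm_smul, norm_inv, Real.norm_of_nonneg (hpos z).le,
      inv_mul_le_iff₀ (hpos z), mul_one]
    exact le_max_right _ _
  have hid : ∀ z ∈ Metric.closedBall (0 : ℂ) 1, r z = z := by
    intro z hz
    rw [mem_closedBall_zero_iff] at hz
    simp [hr, max_eq_left hz]
  have huniv : IsSimplyConnected (univ : Set ℂ) := by
    have := convex_univ.contractibleSpace (univ_nonempty (α := ℂ))
    rw [IsSimplyConnected]
    infer_instance
  obtain ⟨L, hL, hL'⟩ := exists_continuousOn_eqOn_exp_comp huniv isOpen_univ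
    (g := H ∘ r) ((hc.comp_continuous hrc hmem).continuousOn)
    (by rintro ⟨z, -, hz⟩; exact h0 _ (hmem z) hz)
  refine ⟨L, continuousOn_univ.1 hL, fun z hz => ?_⟩
  have := hL' (mem_univ z)
  simpa [hid z hz] using this

/-- The argument principle: a continuous function on the closed unit disk without zeros on the
circle, all of whose zeros `p ∈ S` are such that `G z / (z - p)` stays in a disk avoiding zero,
winds `#S` times around zero. -/
theorem exists_angular_log {G : ℂ → ℂ} (hc : ContinuousOn G (Metric.closedBall 0 1))
    (S : Finset ℂ) (hS : ∀ p ∈ S, p ∈ Metric.ball (0 : ℂ) 1)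
    (h0 : ∀ z ∈ Metric.closedBall (0 : ℂ) 1, z ∉ S → G z ≠ 0)
    (hG : ∀ p ∈ S, AvoidsZeroNear (fun z => G z / (z - p)) p) :
    ∃ Λ : ℝ → ℂ, Continuous Λ ∧ (∀ θ : ℝ, exp (Λ θ) = G (exp (θ * I))) ∧
      Λ (2 * Real.pi) - Λ 0 = 2 * Real.pi * I * S.card := by
  classical
  have hq0 : ∀ z, z ∉ S → ∏ p ∈ S, (z - p) ≠ 0 := fun z hz =>
    Finset.prod_ne_zero_iff.2 fun p hp => sub_ne_zero.2 fun h => hz (h ▸ hp)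
  obtain ⟨H, hHc, hH0, hHeq⟩ := exists_continuousOn_ne_zero (K := Metric.closedBall 0 1)
    (Metric.isClosed_sphere (x := (0 : ℂ)) (ε := 1)) S (fun z => G z / ∏ p ∈ S, (z - p))
    (by
      rw [Set.disjoint_left]
      intro z hz hzS
      have h1 := mem_sphere_zero_iff_norm.1 hz
      have h2 := mem_ball_zero_iff.1 (hS z hzS)
      linarith)
    (by
      refine (hc.mono sdiff_subset).div (by fun_prop) fun z hz => hq0 z hz.2)
    (fun z hz => div_ne_zero (h0 z hz.1 hz.2) (hq0 z hz.2))
    (by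
      intro p hp
      have hne : ∏ s ∈ S.erase p, (p - s) ≠ 0 :=
        Finset.prod_ne_zero_iff.2 fun s hs => sub_ne_zero.2 (Finset.ne_of_mem_erase hs).symm
      refine ((hG p hp).mul (u := fun z => (∏ s ∈ S.erase p, (z - s))⁻¹) ?_
        (inv_ne_zero hne)).congr (Eventually.of_forall fun z => ?_)
      · exact ContinuousAt.inv₀ (by fun_prop) hne
      · simp only
        rw [← Finset.mul_prod_erase S _ hp, div_mul_eq_div_mul_one_div, one_div])
  obtain ⟨L, hLc, hL⟩ := exists_continuous_exp_eq hHc hH0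
  -- On the circle `z - p = z (1 - p / z)` with `|p / z| < 1`: the second factor has a periodic
  -- principal logarithm, so only `z` contributes `2πi`.
  have hsub : ∀ p ∈ S, ∀ θ : ℝ, 1 - p * exp (-(θ * I)) ∈ slitPlane := by
    intro p hp θ
    refine Or.inl ?_
    have hn : ‖p * exp (-(θ * I))‖ < 1 := by
      rw [norm_mul, ← neg_mul, ← ofReal_neg, norm_exp_ofReal_mul_I, mul_one]
      exact mem_ball_zero_iff.1 (hS p hp)
    have := (re_le_norm (p * exp (-(θ * I))))
    rw [sub_re, one_re]
    linarith
  refine ⟨fun θ => L (exp (θ * I)) + ∑ p ∈ S, (θ * I + log (1 - p * exp (-(θ * I)))),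
    ?_, ?_, ?_⟩
  · refine (hLc.comp (by fun_prop)).add (continuous_finsetSum _ fun p hp => ?_)
    exact Continuous.add (by fun_prop) (Continuous.clog (by fun_prop) (hsub p hp))
  · intro θ
    have hmem : exp (θ * I) ∈ Metric.sphere (0 : ℂ) 1 := by simp [norm_exp_ofReal_mul_I]
    rw [exp_add, hL _ (Metric.sphere_subset_closedBall hmem), hHeq hmem, exp_sum]
    have hprod : ∏ p ∈ S, exp (θ * I + log (1 - p * exp (-(θ * I))))
        = ∏ p ∈ S, (exp (θ * I) - p) := by
      refine Finset.prod_congr rfl fun p hp => ?_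
      rw [exp_add, exp_log (slitPlane_ne_zero (hsub p hp θ)), mul_sub, mul_one, mul_left_comm,
        ← exp_add, add_neg_cancel, exp_zero, mul_one]
    rw [hprod, div_mul_cancel₀]
    refine hq0 _ fun hmS => ?_
    have h1 := mem_sphere_zero_iff_norm.1 hmem
    have h2 := mem_ball_zero_iff.1 (hS _ hmS)
    linarith
  · simp only [ofReal_mul, ofReal_ofNat, exp_two_pi_mul_I, ofReal_zero, zero_mul, exp_zero,
      exp_neg, inv_one, neg_zero, Finset.sum_add_distrib, Finset.sum_const, nsmul_eq_mul]
    ring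

/-! ### The winding integral as a variation of logarithm. -/

theorem hasDerivAt_of_exp_eq {Λ f : ℝ → ℂ} (hΛ : Continuous Λ) (hf : ∀ t, exp (Λ t) = f t)
    {t : ℝ} {f' : ℂ} (hd : HasDerivAt f f' t) : HasDerivAt Λ (f' / f t) t := by
  have hft : f t ≠ 0 := hf t ▸ exp_ne_zero _
  have hd' : HasDerivAt (fun s => Λ t + log (f s / f t)) (f' / f t) t := by
    have h1 : f t / f t = 1 := div_self hft
    have h2 := (hd.div_const (f t)).clog_real (by rw [h1]; exact one_mem_slitPlane)
    rw [h1, div_one] at h2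
    exact h2.const_add _
  refine hd'.congr_of_eventuallyEq ?_
  have him : ContinuousAt (fun s => |(Λ s - Λ t).im|) t :=
    (continuous_abs.comp (continuous_im.comp (hΛ.sub continuous_const))).continuousAt
  -- Within this strip `Λ s - Λ t` is the principal logarithm of `f s / f t`.
  have hev : ∀ᶠ s in 𝓝 t, |(Λ s - Λ t).im| < Real.pi :=
    him.eventually_lt continuousAt_const (by simpa using Real.pi_pos)
  filter_upwards [hev] with s hs
  rw [abs_lt] at hs
  rw [← hf, ← hf, ← exp_sub, log_exp hs.1 hs.2.le]
  ring

/-- The winding number is the variation of a continuous logarithm. -/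
theorem windingNumber_eq_of_exp_eq {γ : Circle → ℂ} (hγ : IsPiecewiseSmoothClosedCurve γ) {P : ℂ}
    {Λ : ℝ → ℂ} (hΛ : Continuous Λ) (h : ∀ θ, exp (Λ θ) = angular γ θ - P) :
    windingNumber γ P = (2 * Real.pi * I)⁻¹ * (Λ (2 * Real.pi) - Λ 0) := by
  obtain ⟨-, n, t, h0, hn, ht⟩ := hγ
  have hne : ∀ θ, angular γ θ - P ≠ 0 := fun θ => h θ ▸ exp_ne_zero _
  set f : ℝ → ℂ := fun θ => deriv (angular γ) θ / (angular γ θ - P) with hf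
  have hint : ∀ i < n, IntervalIntegrable f MeasureTheory.volume (t i) (t (i + 1)) := by
    intro i hi
    obtain ⟨hlt, hsm, -⟩ := ht i hi
    have hcont : ContinuousOn (fun θ => derivWithin (angular γ) (Icc (t i) (t (i + 1))) θ /
        (angular γ θ - P)) (Icc (t i) (t (i + 1))) :=
      (hsm.continuousOn_derivWithin (uniqueDiffOn_Icc hlt) (by simp)).div
        (hsm.continuousOn.sub continuousOn_const) fun θ _ => hne θ
    rw [← uIcc_of_le hlt.le] at hcont
    -- Two-sided and one-sided derivatives need agree only inside the piece, so corners do no harm.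
    refine hcont.intervalIntegrable.congr_uIoo fun θ hθ => ?_
    rw [uIoo_of_le hlt.le] at hθ
    rw [uIcc_of_le hlt.le]
    simp only [hf]
    rw [derivWithin_of_mem_nhds (Icc_mem_nhds hθ.1 hθ.2)]
  have hpiece : ∀ i < n, ∫ θ in (t i)..(t (i + 1)), f θ = Λ (t (i + 1)) - Λ (t i) := by
    intro i hi
    obtain ⟨hlt, hsm, -⟩ := ht i hi
    refine intervalIntegral.integral_eq_sub_of_hasDerivAt_of_le hlt.le hΛ.continuousOn
      (fun θ hθ => ?_) (hint i hi)
    have hd : DifferentiableAt ℝ (angular γ) θ :=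
      (hsm.differentiableOn (by simp)).differentiableAt (Icc_mem_nhds hθ.1 hθ.2)
    exact hasDerivAt_of_exp_eq hΛ h (hd.hasDerivAt.sub_const P)
  rw [windingNumber, ← h0, ← hn, ← intervalIntegral.sum_integral_adjacent_intervals hint,
    Finset.sum_congr rfl fun i hi => hpiece i (Finset.mem_range.1 hi),
    Finset.sum_range_sub (fun i => Λ (t i))]

/-! ### Layers and winding numbers. -/

theorem Bounds.finite_preimage {γ : Circle → ℂ} {F : ℂ → ℂ} (hF : Bounds γ F) {P : ℂ}
    (hP : P ∈ (range γ)ᶜ) : {z ∈ Metric.ball (0 : ℂ) 1 | F z = P}.Finite := by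
  have hset : {z ∈ Metric.ball (0 : ℂ) 1 | F z = P} = Metric.closedBall 0 1 ∩ F ⁻¹' {P} := by
    ext z
    refine ⟨fun hz => ⟨Metric.ball_subset_closedBall hz.1, hz.2⟩, fun hz => ⟨?_, hz.2⟩⟩
    have hz1 := mem_closedBall_zero_iff.1 hz.1
    rw [mem_ball_zero_iff]
    refine lt_of_le_of_ne hz1 fun heq => hP ?_
    exact ⟨⟨z, mem_sphere_zero_iff_norm.2 heq⟩, (hF.2 _).symm.trans hz.2⟩
  have hcomp : IsCompact {z ∈ Metric.ball (0 : ℂ) 1 | F z = P} := by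
    rw [hset]
    exact (isCompact_closedBall _ _).of_isClosed_subset
      (hF.1.continuousOn.preimage_isClosed_of_isClosed Metric.isClosed_closedBall
        isClosed_singleton) inter_subset_left
  -- An infinite compact fibre would accumulate at one of its points, where zeros of `F - P` are
  -- isolated.
  by_contra hinf
  obtain ⟨p, hp, hacc⟩ :=
    Set.Infinite.exists_accPt_of_subset_isCompact hinf hcomp Subset.rfl
  have hav := (avoidsZeroNear_div_sub ((hF.1.differentiableAt p hp.1).hasFDerivAt.sub_const P)
    (by simp [hp.2]) (hF.1.det_pos p hp.1)).eventually_ne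
  rw [accPt_iff_frequently_nhdsNE] at hacc
  obtain ⟨z, hz, hz'⟩ := (hacc.and_eventually hav).exists
  exact hz' (by simp [hz.2])

theorem Bounds.exists_angular_log {γ : Circle → ℂ} {F : ℂ → ℂ} (hF : Bounds γ F) {P : ℂ}
    (hP : P ∈ (range γ)ᶜ) :
    ∃ Λ : ℝ → ℂ, Continuous Λ ∧ (∀ θ, exp (Λ θ) = angular γ θ - P) ∧
      Λ (2 * Real.pi) - Λ 0 =
        2 * Real.pi * I * {z ∈ Metric.ball (0 : ℂ) 1 | F z = P}.ncard := by
  have hfin := hF.finite_preimage hP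
  obtain ⟨Λ, h1, h2, h3⟩ := SelfOverlapping.exists_angular_log (G := fun z => F z - P)
    (hF.1.continuousOn.sub continuousOn_const) hfin.toFinset
    (fun p hp => (hfin.mem_toFinset.1 hp).1)
    (by
      intro z hz hzS h0
      rcases (mem_closedBall_zero_iff.1 hz).lt_or_eq with hlt | heq
      · exact hzS (hfin.mem_toFinset.2 ⟨mem_ball_zero_iff.2 hlt, sub_eq_zero.1 h0⟩)
      · exact hP ⟨⟨z, mem_sphere_zero_iff_norm.2 heq⟩,
          (hF.2 _).symm.trans (sub_eq_zero.1 h0)⟩)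
    (by
      intro p hp
      obtain ⟨hpb, hpP⟩ := hfin.mem_toFinset.1 hp
      exact avoidsZeroNear_div_sub ((hF.1.differentiableAt p hpb).hasFDerivAt.sub_const P)
        (by simp [hpP]) (hF.1.det_pos p hpb))
  refine ⟨Λ, h1, fun θ => ?_, ?_⟩
  · rw [h2, angular, ← hF.2, Circle.coe_exp]
  · rw [h3, Set.ncard_eq_toFinset_card _ hfin]

theorem Bounds.windingNumber_eq {γ : Circle → ℂ} {F : ℂ → ℂ}
    (hγ : IsPiecewiseSmoothClosedCurve γ) (hF : Bounds γ F) {P : ℂ} (hP : P ∈ (range γ)ᶜ) :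
    windingNumber γ P = ({z ∈ Metric.ball (0 : ℂ) 1 | F z = P}.ncard : ℂ) := by
  obtain ⟨Λ, h1, h2, h3⟩ := hF.exists_angular_log hP
  rw [windingNumber_eq_of_exp_eq hγ h1 h2, h3, inv_mul_cancel_left₀ two_pi_I_ne_zero]

/-- Factor `γ - Q = (γ - P) (1 + (P - Q) / (γ - P))`. For `Q` close to `P` the last factor stays
within distance `1` of `1`, so its principal logarithm is continuous and returns to its initial
value. -/
theorem eventually_windingNumber_eq {γ : Circle → ℂ} (hγ : IsPiecewiseSmoothClosedCurve γ) {P : ℂ}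
    (hP : P ∈ (range γ)ᶜ) {Λ : ℝ → ℂ} (hΛ : Continuous Λ)
    (h : ∀ θ, exp (Λ θ) = angular γ θ - P) :
    ∀ᶠ Q in 𝓝 P, windingNumber γ Q = windingNumber γ P := by
  have hopen : IsOpen (range γ)ᶜ := (isCompact_range hγ.1).isClosed.isOpen_compl
  obtain ⟨ε, hε, hball⟩ := Metric.isOpen_iff.1 hopen P hP
  filter_upwards [Metric.ball_mem_nhds P hε] with Q hQ
  have hang : Continuous (angular γ) := hγ.1.comp Circle.exp.continuous
  have hne : ∀ θ, angular γ θ - P ≠ 0 := fun θ => h θ ▸ exp_ne_zero _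
  have hslit : ∀ θ, 1 + (P - Q) / (angular γ θ - P) ∈ slitPlane := by
    intro θ
    have hfar : ε ≤ ‖angular γ θ - P‖ := by
      by_contra! hlt
      exact hball (mem_ball_iff_norm.2 hlt) ⟨_, rfl⟩
    have hnorm : ‖(P - Q) / (angular γ θ - P)‖ < 1 := by
      rw [norm_div, div_lt_one (norm_pos_iff.2 (hne θ)), norm_sub_rev]
      exact (mem_ball_iff_norm.1 hQ).trans_le hfar
    exact mem_slitPlane_of_norm_lt_one hnorm
  have hper : angular γ (2 * Real.pi) = angular γ 0 := by
    simp [angular]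
  rw [windingNumber_eq_of_exp_eq hγ hΛ h, windingNumber_eq_of_exp_eq hγ
    (Λ := fun θ => Λ θ + log (1 + (P - Q) / (angular γ θ - P)))]
  · simp only [hper]
    ring
  · refine hΛ.add (Continuous.clog ?_ hslit)
    exact continuous_const.add (continuous_const.div (hang.sub continuous_const) hne)
  · intro θ
    rw [exp_add, exp_log (slitPlane_ne_zero (hslit θ)), h, mul_add, mul_one,
      mul_div_cancel₀ _ (hne θ)]
    ring

end SelfOverlapping

theorem mainTheorem5 (γ : Circle → ℂ) (hγ : SelfOverlapping.IsSelfOverlapping γ) :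
    (∀ F : ℂ → ℂ, SelfOverlapping.Bounds γ F →
      ∀ Ω : Set ℂ, SelfOverlapping.IsBoundedComponent γ Ω →
        ∃ ν : ℕ, (∀ P ∈ Ω, SelfOverlapping.layersAt F P = (ν : ℕ∞)) ∧
          ∀ P ∈ Ω, SelfOverlapping.windingNumber γ P = (ν : ℂ)) ∧
    ∀ P ∈ (Set.range γ)ᶜ, ∃ k : ℕ, SelfOverlapping.windingNumber γ P = (k : ℂ) := by
  obtain ⟨hsm, F₀, hF₀⟩ := hγ
  refine ⟨?_, fun P hP => ⟨_, hF₀.windingNumber_eq hsm hP⟩⟩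
  rintro F hF Ω ⟨-, P₀, hP₀, rfl⟩
  have hopen : IsOpen (Set.range γ)ᶜ := (isCompact_range hsm.1).isClosed.isOpen_compl
  have hsub := connectedComponentIn_subset (Set.range γ)ᶜ P₀
  set N : ℂ → ℕ := fun P => {z ∈ Metric.ball (0 : ℂ) 1 | F z = P}.ncard with hN
  -- Local constancy passes from the winding number to the count; a continuous map to `ℕ` is
  -- constant on a preconnected set.
  have hcont : ContinuousOn N (connectedComponentIn (Set.range γ)ᶜ P₀) := by
    intro P hP
    refine ContinuousAt.continuousWithinAt ?_
    obtain ⟨Λ, h1, h2, -⟩ := hF.exists_angular_log (hsub hP)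
    refine (continuousAt_const (y := N P)).congr ?_
    filter_upwards [SelfOverlapping.eventually_windingNumber_eq hsm (hsub hP) h1 h2,
      hopen.mem_nhds (hsub hP)] with Q hQ hQ'
    rw [hF.windingNumber_eq hsm (hsub hP), hF.windingNumber_eq hsm hQ'] at hQ
    exact (Nat.cast_injective hQ).symm
  have hconst : ∀ P ∈ connectedComponentIn (Set.range γ)ᶜ P₀, N P = N P₀ := fun P hP =>
    isPreconnected_connectedComponentIn.constant hcont hP (mem_connectedComponentIn hP₀)
  refine ⟨N P₀, fun P hP => ?_, fun P hP => ?_⟩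
  · rw [← hconst P hP, SelfOverlapping.layersAt,
      (hF.finite_preimage (hsub hP)).cast_ncard_eq]
  · rw [← hconst P hP, hF.windingNumber_eq hsm (hsub hP)]
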